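/- **Colored graphs.** A *4-colored graph* is an infinite connected simple graph with a proper edge-coloring by $A,B,C,D$ (edges at a common vertex have distinct colors). For a vertex $x$ and $r\in\mathbb N$ let $B_r(x)$ be the subgraph spanned by the vertices at distance at most $r$ from $x$, with its coloring and the root $x$. Two vertices $x,y$ have the same $r$-type if there is a color-preserving graph isomorphism $B_r(x)\to B_r(y)$ mapping $x$ to $y$. The graph is *generic* if for any two vertices $x\ne y$ there is $r>0$ such that the $r$-types of $x$ and $y$ are different. **The construction.** Fix an integer $m>10$. Let $\Gamma=\mathbb Z_2*\mathbb Z_2*\mathbb Z_2*\mathbb Z_2$ with generators $A,B,C,D$ of order two, let $\widetilde\Gamma=\langle A,B,C\rangle$, and fix a decreasing sequence of finite index normal subgroups $N_i\lhd\widetilde\Gamma$ with $\bigcap_i N_i=\{1\}$. Let $C_i$ be the cycle of length $2i$, its edges colored alternately by $A$ and $B$, and let $K_i$ be the Cayley graph of $\widetilde\Gamma/N_i$ with respect to $A,B,C$, its edges colored by $A,B,C$. Enumerate the nonempty reduced words in $A,B,C,D$ by length and then lexicographically: $A,B,C,D,AB,AC,AD,BA,\dots$. Construct $G_0\subset G_1\subset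 G_2\subset\cdots$ as follows, where $s_i:=m^i\,2^{|V(G_{i-1})|}$ for $i\ge1$ (so $s_1=2m$). * *Step 0.* $G_0$ is a single vertex $p=:r_0$. * *Step 1.* $H_1$ is a triangle with edges colored $A,B,C$. Pick distinct vertices $q,r_1$ of $H_1$. $G_1$ consists of $G_0$, $H_1$ and an edge of color $D$ between $p$ and $q$. * *Step $n\ge2$.* Let $H_n$ be some $C_i$ if $n$ is even and some $K_i$ if $n$ is odd, such that $\operatorname{diam}H_n\ge10s_n$ and $H_n$ is a properly edge-colored simple graph (for $K_i$: $A,B,C$ have nontrivial, pairwise distinct images in $\widetilde\Gamma/N_i$). Choose a partition $V(H_n)=R^n_1\sqcup\dots\sqcup R^n_{n+1}$ such that for $1\le i\le n$ distinct points of $R^n_i$ are at distance at least $2s_i$ in $H_n$, and each vertex of $H_n$ is at distance at most $10s_i$ from some point of $R^n_i$. For $1\le i\le n-1$ and each $v\in R^n_i$ take a new copy of $G_{i-1}$ and connect $v$ to its vertex $r_{i-1}$ by an edge of color $D$. Connect one vertex of $R^n_n$ to the vertex $r_{n-1}$ of $G_{n-1}$ itself by an edge of color $D$. Pick distinct vertices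 $x_n,r_n\in R^n_{n+1}$. Let $w=w_k\cdots w_2w_1$ be the first word of the enumeration if $n=2$ and the $n$th word if $n\ge3$. Attach to $x_n$ a path with new vertices whose successive edges, starting at $x_n$, have the colors $w_1,w_2,\dots,w_k$ if $w_1=D$ and $D,w_1,w_2,\dots,w_k$ if $w_1\ne D$. The result is $G_n$. Let $G=\bigcup_n G_n$. **Proposition.** For every $m>10$, every such sequence $(N_i)$ and all admissible choices in the construction, $G$ is a 4-colored graph and it is generic. -/

import Mathlib

/-- The four edge colors. -/
inductive Color where
  | A | B | C | D
deriving DecidableEq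

/-! ### Colored graphs -/

/-- A vertex set with a symmetric relation `Adj c` for each color `c`
(`Adj c x y`: there is an edge of color `c` between `x` and `y`). -/
structure ColoredGraph where
  V : Type
  Adj : Color → V → V → Prop
  symm : ∀ {c : Color} {x y : V}, Adj c x y → Adj c y x

namespace ColoredGraph

/-- The underlying uncolored graph. -/
def graph (G : ColoredGraph) : SimpleGraph G.V where
  Adj x y := x ≠ y ∧ ∃ c, G.Adj c x y
  symm := ⟨fun _ _ h => ⟨h.1.symm, h.2.imp fun _ h' => G.symm h'⟩⟩
  loopless := ⟨fun _ h => h.1 rfl⟩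

/-- `G` is a simple graph with a proper edge-coloring: there are no loops, every edge has
exactly one color, and distinct edges at a vertex have distinct colors. -/
structure IsProper (G : ColoredGraph) : Prop where
  no_loop : ∀ c x, ¬ G.Adj c x x
  one_color : ∀ c c' x y, G.Adj c x y → G.Adj c' x y → c = c'
  proper : ∀ c x y z, G.Adj c x y → G.Adj c x z → y = z

/-- A 4-colored graph: infinite, connected, with a proper edge-coloring by `A, B, C, D`. -/
structure IsFourColored (G : ColoredGraph) : Prop where
  infinite : Infinite G.V
  connected : G.graph.Connected
  isProper : G.IsProper

/-- The vertex set of the ball `B_r(x)` for the shortest path metric. -/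
def ball (G : ColoredGraph) (x : G.V) (r : ℕ) : Set G.V :=
  {y | G.graph.edist x y ≤ r}

/-- `x` and `y` have the same `r`-type: there is an isomorphism of the subgraphs spanned by
`B_r(x)` and `B_r(y)` which preserves the edge-colors and maps `x` to `y`. -/
def SameType (G : ColoredGraph) (r : ℕ) (x y : G.V) : Prop :=
  ∃ θ : G.ball x r ≃ G.ball y r,
    (∀ u : G.ball x r, (u : G.V) = x → (θ u : G.V) = y) ∧
    ∀ (c : Color) (u v : G.ball x r), G.Adj c u v ↔ G.Adj c (θ u) (θ v)

/-- Any two distinct vertices have different `r`-types for some `r > 0`. -/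
def IsGeneric (G : ColoredGraph) : Prop :=
  ∀ x y : G.V, x ≠ y → ∃ r : ℕ, 0 < r ∧ ¬ G.SameType r x y

end ColoredGraph

/-! ### The building blocks -/

/-- A triangle whose edges have the colors `A`, `B` and `C`. -/
def triangle : ColoredGraph where
  V := Fin 3
  Adj c x y := (c = .A ∧ s(x, y) = s(0, 1)) ∨ (c = .B ∧ s(x, y) = s(1, 2)) ∨
    (c = .C ∧ s(x, y) = s(0, 2))
  symm {c x y} h := by rwa [Sym2.eq_swap]

/-- The cycle of length `2 * i`, its edges being colored alternately by `A` and `B`.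
(For `i = 0` this is an infinite path and for `i = 1` a double edge; both are excluded below
by the condition on the diameter.) -/
def coloredCycle (i : ℕ) : ColoredGraph where
  V := ZMod (2 * i)
  Adj c x y := (c = .A ∧ ∃ k : ZMod (2 * i), Even k.val ∧ s(x, y) = s(k, k + 1)) ∨
    (c = .B ∧ ∃ k : ZMod (2 * i), Odd k.val ∧ s(x, y) = s(k, k + 1))
  symm {c x y} h := by rwa [Sym2.eq_swap]

/-- The free product of four cyclic groups of order two. -/
abbrev Gam : Type := Monoid.CoprodI (fun _ : Color => Multiplicative (ZMod 2))

/-- The four generators of order two. -/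
def gen (c : Color) : Gam :=
  Monoid.CoprodI.of (M := fun _ : Color => Multiplicative (ZMod 2)) (i := c)
    (Multiplicative.ofAdd 1)

theorem gen_mul_gen (c : Color) : gen c * gen c = 1 := by
  unfold gen
  rw [← map_mul, ← ofAdd_add, show (1 + 1 : ZMod 2) = 0 from rfl, ofAdd_zero, map_one]

/-- The subgroup generated by `A`, `B` and `C`. -/
def GamABC : Subgroup Gam := Subgroup.closure {gen .A, gen .B, gen .C}

/-- A decreasing sequence of finite index normal subgroups with trivial intersection. -/
structure ResidualChain where
  N : ℕ → Subgroup GamABC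
  normal : ∀ i, (N i).Normal
  finiteIndex : ∀ i, (N i).FiniteIndex
  decreasing : Antitone N
  iInf_eq_bot : ⨅ i, N i = ⊥

/-- The Cayley graph of the quotient of `⟨A, B, C⟩` by `N i`, with edges `x — x * c` of color `c`
for `c = A, B, C`. -/
def cayleyGraph (K : ResidualChain) (i : ℕ) : ColoredGraph where
  V := GamABC ⧸ K.N i
  Adj c x y := letI := K.normal i
    c ≠ .D ∧ ∃ g : GamABC, (g : Gam) = gen c ∧ y = x * (g : GamABC ⧸ K.N i)
  symm {c x y} h := by
    let _ := K.normal i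
    obtain ⟨hc, g, hg, rfl⟩ := h
    refine ⟨hc, g, hg, ?_⟩
    have h1 : g * g = 1 := Subtype.ext (by simp [hg, gen_mul_gen])
    rw [mul_assoc, ← QuotientGroup.mk_mul, h1, QuotientGroup.mk_one, mul_one]

/-- The reduced words of length `k` in the letters `A, B, C, D` in lexicographic order. -/
def wordsOfLength : ℕ → List (List Color)
  | 0 => [[]]
  | k + 1 => [Color.A, .B, .C, .D].flatMap fun c =>
      ((wordsOfLength k).filter fun u => u.head? ≠ some c).map fun u => c :: u

/-- The `n`-th term (`n ≥ 1`) of the enumeration `A, B, C, D, AB, AC, AD, BA, …` of the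
nonempty reduced words, first by length and then lexicographically. -/
def nthWord (n : ℕ) : List Color :=
  ((List.range (n + 1)).flatMap wordsOfLength).getD n []

/-- The word used in step `n`: none in step `1`, the first word in step `2`, and the `n`-th word
in step `n ≥ 3`. -/
def stepWord : ℕ → List Color
  | 0 => []
  | 1 => []
  | 2 => nthWord 1
  | n + 3 => nthWord (n + 3)

/-- The colors along the path which is attached in step `n`. For a word `w_k ⋯ w_2 w_1` they are
`w_1, w_2, …, w_k` if `w_1 = D` and `D, w_1, w_2, …, w_k` otherwise. -/
def pathColors (n : ℕ) : List Color :=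
  match (stepWord n).reverse with
  | [] => []
  | c :: w => if c = .D then c :: w else .D :: c :: w

/-! ### The inductive construction -/

/-- The graph `H_n`: a triangle for `n = 1`, one of the cycles if `n ≥ 2` is even, and one
of the Cayley graphs if `n ≥ 2` is odd; `idx n` is the chosen index in these sequences. The value
for `n = 0` is not used. -/
def core (K : ResidualChain) (idx : ℕ → ℕ) : ℕ → ColoredGraph
  | 0 => triangle
  | 1 => triangle
  | n + 2 => if Even n then coloredCycle (idx (n + 2)) else cayleyGraph K (idx (n + 2))

/-- The choices made in the construction. The conditions that they have to satisfy
are collected in `Choices.Valid`. -/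
structure Choices (K : ResidualChain) where
  /-- which cycle or Cayley graph is taken as `H_n` -/
  idx : ℕ → ℕ
  /-- the partition of `V(H_n)`: the class `R^n_i` is `{v | part n v = i}` -/
  part : ∀ n, (core K idx n).V → ℕ
  /-- the vertex of `H_n` to which `G_{n-1}` itself gets attached (for `n = 1`, this is `q`) -/
  a : ∀ n, (core K idx n).V
  /-- the vertex of `H_n` to which the path of step `n ≥ 2` gets attached -/
  x : ∀ n, (core K idx n).V
  /-- the vertex `r_n` at which `G_n` and its copies get attached to other graphs -/
  r : ∀ n, (core K idx n).V

namespace Choices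

variable {K : ResidualChain}

/-- The graph `H_n`. -/
def H (c : Choices K) (n : ℕ) : ColoredGraph := core K c.idx n

/-- The set `V(G_n) \ V(G_{n-1})` of the vertices which are new in step `n`. In step `n + 1` they
are the vertices of `H_{n+1}`, those of the copies of `G_{i-1}` attached to
the vertices `v ∈ R^{n+1}_i` with `1 ≤ i ≤ n` (a vertex of such a copy is given by a vertex of
`G_{i-1}`, that is a `k < i` and an element of `V(G_k) \ V(G_{k-1})`), and those of the path. -/
inductive New (c : Choices K) : ℕ → Type
  | point : New c 0
  | core (n : ℕ) (v : (c.H (n + 1)).V) : New c (n + 1)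
  | copy (n : ℕ) (v : (c.H (n + 1)).V) (hv : c.part (n + 1) v ≤ n)
      (k : ℕ) (hk : k < c.part (n + 1) v) (y : New c k) : New c (n + 1)
  | path (n : ℕ) (j : Fin (pathColors (n + 1)).length) : New c (n + 1)

/-- The vertices of `G`; `⟨n, y⟩` appears in step `n`. -/
abbrev Vert (c : Choices K) : Type := Σ n : ℕ, c.New n

/-- `V(G_n)` as a subset of `V(G)`. -/
def stage (c : Choices K) (n : ℕ) : Set c.Vert := {y | y.1 ≤ n}

/-- The vertex of `G_n` at which `G_n` is attached: `r_n`, and the single vertex `p` if `n = 0`. -/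
def root (c : Choices K) : (n : ℕ) → c.New n
  | 0 => .point
  | n + 1 => .core n (c.r (n + 1))

/-- The edges of `G`, each of them in at least one of its two directions. -/
inductive Link (c : Choices K) : Color → c.Vert → c.Vert → Prop
  /-- the edges of `H_{n+1}` -/
  | core (n : ℕ) (e : Color) (v w : (c.H (n + 1)).V) (h : (c.H (n + 1)).Adj e v w) :
      Link c e ⟨n + 1, .core n v⟩ ⟨n + 1, .core n w⟩
  /-- the edge between `H_{n+1}` and `G_n` -/
  | attach (n : ℕ) : Link c .D ⟨n + 1, .core n (c.a (n + 1))⟩ ⟨n, c.root n⟩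
  /-- the edges inside the copy of `G_{i-1}` attached to `v ∈ R^{n+1}_i` -/
  | copy (n : ℕ) (v : (c.H (n + 1)).V) (hv : c.part (n + 1) v ≤ n) (e : Color)
      (k : ℕ) (hk : k < c.part (n + 1) v) (y : c.New k)
      (l : ℕ) (hl : l < c.part (n + 1) v) (z : c.New l) (h : Link c e ⟨k, y⟩ ⟨l, z⟩) :
      Link c e ⟨n + 1, .copy n v hv k hk y⟩ ⟨n + 1, .copy n v hv l hl z⟩
  /-- the edge between `v ∈ R^{n+1}_i` and its copy of `G_{i-1}`; here `i = k + 1` -/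
  | attachCopy (n : ℕ) (v : (c.H (n + 1)).V) (hv : c.part (n + 1) v ≤ n)
      (k : ℕ) (hk : k < c.part (n + 1) v) (h : c.part (n + 1) v = k + 1) :
      Link c .D ⟨n + 1, .core n v⟩ ⟨n + 1, .copy n v hv k hk (c.root k)⟩
  /-- the edges of the path, starting at `x_{n+1}` -/
  | pathStart (n : ℕ) (h : 0 < (pathColors (n + 1)).length) :
      Link c (pathColors (n + 1))[0] ⟨n + 1, .core n (c.x (n + 1))⟩ ⟨n + 1, .path n ⟨0, h⟩⟩
  | pathStep (n j : ℕ) (h : j + 1 < (pathColors (n + 1)).length) :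
      Link c (pathColors (n + 1))[j + 1]
        ⟨n + 1, .path n ⟨j, Nat.lt_of_succ_lt h⟩⟩ ⟨n + 1, .path n ⟨j + 1, h⟩⟩

/-- The graph `G`, the union of the graphs `G_n`, where `G_n` is the subgraph spanned
by `c.stage n`. -/
def G (c : Choices K) : ColoredGraph where
  V := c.Vert
  Adj e y z := c.Link e y z ∨ c.Link e z y
  symm h := h.symm

/-- `s_n = m ^ n * 2 ^ |V(G_{n-1})|` for `n ≥ 1`; in particular `s_1 = 2 * m`. -/
noncomputable def s (c : Choices K) (m n : ℕ) : ℕ :=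
  m ^ n * 2 ^ Nat.card (c.stage (n - 1))

/-- The conditions on the choices in step `n ≥ 2`. -/
structure ValidStep (c : Choices K) (m n : ℕ) : Prop where
  /-- `H_n` is a properly colored simple graph (automatic for the cycles of length `≥ 4`) -/
  isProper : (c.H n).IsProper
  diam : 10 * c.s m n ≤ (c.H n).graph.diam
  /-- the sets `R^n_1, …, R^n_{n+1}` cover `V(H_n)` -/
  part_mem : ∀ v : (c.H n).V, 1 ≤ c.part n v ∧ c.part n v ≤ n + 1
  /-- `R^n_i` is a `2 s_i`-net for `i = 1, …, n` -/
  net : ∀ i, 1 ≤ i → i ≤ n → ∀ u v : (c.H n).V, c.part n u = i → c.part n v = i → u ≠ v →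
    2 * c.s m i ≤ (c.H n).graph.dist u v
  /-- every vertex is at distance at most `10 s_i` from `R^n_i` for `i = 1, …, n` -/
  dense : ∀ i, 1 ≤ i → i ≤ n → ∀ v : (c.H n).V, ∃ p : (c.H n).V, c.part n p = i ∧
    (c.H n).graph.dist p v ≤ 10 * c.s m i
  part_a : c.part n (c.a n) = n
  part_x : c.part n (c.x n) = n + 1
  part_r : c.part n (c.r n) = n + 1
  r_ne_x : c.r n ≠ c.x n

/-- The choices are admissible for the construction with parameter `m`. -/
structure Valid (c : Choices K) (m : ℕ) : Prop where
  r_ne_a : c.r 1 ≠ c.a 1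
  step : ∀ n, 2 ≤ n → c.ValidStep m n

end Choices

/-! ### Words -/

/-! $G$ is exhausted by the finite connected subgraphs $G_n$, and exactly one edge leaves $G_n$: the
`D`-edge from $r_n$ to $H_{n+1}$ (`eq_of_adj_of_fst_lt`). Genericity follows from this and from
properness of the coloring.

Given $x, y \in G_n$, choose $r$ such that walks of length at most $r$ inside $G_n$ lead from $x$ to
all of $G_n$, and suppose $\theta$ identifies the $(r+1)$-balls of $x$ and $y$. Then $\theta(G_n)$
is connected, contains $y$, has as many vertices as $G_n$ and again has only one leaving edge. In an
infinite connected graph two such sets that meet coincide (`range_eq_of_unique_boundary`), so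
$\theta(G_n)=G_n$. The leaving edge is preserved, hence $\theta$ fixes $r_n$. A color-preserving map
that fixes one vertex of a connected properly colored graph is the identity, so $x=y$.

Properness (`Valid.G_isProper`) is a matter of the color `D` at vertices of the $H_n$ and at the
roots of copies, and of reducedness of the words along the paths. -/

theorem isChain_of_mem_wordsOfLength {k : ℕ} {w : List Color} (h : w ∈ wordsOfLength k) :
    w.IsChain (· ≠ ·) := by
  induction k generalizing w with
  | zero => simp_all [wordsOfLength]
  | succ k ih =>
    simp only [wordsOfLength, List.mem_flatMap, List.mem_map, List.mem_filter] at h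
    obtain ⟨c, -, u, ⟨hu, hc⟩, rfl⟩ := h
    refine List.isChain_cons.2 ⟨fun d hd => ?_, ih hu⟩
    rintro rfl
    simp_all

theorem isChain_nthWord (n : ℕ) : (nthWord n).IsChain (· ≠ ·) := by
  unfold nthWord
  rw [List.getD_eq_getElem?_getD]
  cases h : ((List.range (n + 1)).flatMap wordsOfLength)[n]? with
  | none => simp
  | some w =>
    obtain ⟨k, -, hk⟩ := List.mem_flatMap.1 (List.mem_of_getElem? h)
    exact isChain_of_mem_wordsOfLength hk

theorem isChain_stepWord (n : ℕ) : (stepWord n).IsChain (· ≠ ·) := by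
  match n with
  | 0 => simp [stepWord]
  | 1 => simp [stepWord]
  | 2 => exact isChain_nthWord 1
  | n + 3 => exact isChain_nthWord (n + 3)

/-- Reversal keeps a word reduced, and `D` is prepended only when the first color is not `D`. Hence
the coloring is proper at interior vertices of the attached path. -/
theorem isChain_pathColors (n : ℕ) : (pathColors n).IsChain (· ≠ ·) := by
  have h : (stepWord n).reverse.IsChain (· ≠ ·) := by
    rw [List.isChain_reverse]
    exact (isChain_stepWord n).imp fun _ _ => Ne.symm
  unfold pathColors
  split
  · simp
  · split_ifs with hc
    · simp_all
    · rename_i heq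
      rw [heq] at h
      exact List.isChain_cons_cons.2 ⟨fun h' => hc h'.symm, h⟩

theorem pathColors_succ_ne (n j : ℕ) (h : j + 1 < (pathColors n).length) :
    (pathColors n)[j] ≠ (pathColors n)[j + 1] :=
  List.isChain_iff_getElem.1 (isChain_pathColors n) j h

theorem pathColors_zero (n : ℕ) (h : 0 < (pathColors n).length) : (pathColors n)[0] = .D := by
  revert h
  unfold pathColors
  split
  · simp
  · split_ifs with hc <;> simp [hc]

/-! ### The building blocks -/

theorem triangle_isProper : triangle.IsProper where
  no_loop c (x : Fin 3) h := by
    revert h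
    simp only [triangle]
    fin_cases x <;> cases c <;> simp
  one_color c c' (x : Fin 3) (y : Fin 3) := by
    simp only [triangle]
    fin_cases x <;> fin_cases y <;> cases c <;> cases c' <;> simp
  proper c (x : Fin 3) (y : Fin 3) (z : Fin 3) := by
    simp only [triangle]
    fin_cases x <;> fin_cases y <;> cases c <;> fin_cases z <;> simp

theorem triangle_connected : triangle.graph.Connected := by
  have : Nonempty triangle.V := ⟨(0 : Fin 3)⟩
  refine ⟨fun (x : Fin 3) (y : Fin 3) => ?_⟩
  by_cases hxy : x = y
  · exact hxy ▸ SimpleGraph.Reachable.rfl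
  · refine SimpleGraph.Adj.reachable ⟨hxy, ?_⟩
    fin_cases x <;> fin_cases y <;> simp at hxy <;>
      first
      | exact ⟨.A, Or.inl ⟨rfl, by decide⟩⟩
      | exact ⟨.B, Or.inr (Or.inl ⟨rfl, by decide⟩)⟩
      | exact ⟨.C, Or.inr (Or.inr ⟨rfl, by decide⟩)⟩

/-! ### Finiteness of the graphs $H_n$ and their lack of `D`-edges -/

theorem abs_sub_le_walk_length {V : Type*} {g : SimpleGraph V} (f : V → ℤ)
    (hf : ∀ u v, g.Adj u v → |f u - f v| ≤ 1) {x y : V} (p : g.Walk x y) :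
    |f x - f y| ≤ p.length := by
  induction p with
  | nil => simp
  | @cons u v w h p ih =>
    rw [SimpleGraph.Walk.length_cons, Nat.cast_add, Nat.cast_one]
    linarith [abs_sub_le (f u) (f v) (f w), hf u v h]

theorem finite_coloredCycle (i : ℕ) (h : 0 < (coloredCycle i).graph.diam) :
    Finite (coloredCycle i).V := by
  rcases Nat.eq_zero_or_pos i with rfl | hi
  · exfalso
    let g := (coloredCycle 0).graph
    let f : (coloredCycle 0).V ≃ ℤ := Equiv.refl ℤ
    have hf : ∀ u v, g.Adj u v → |f u - f v| ≤ 1 := by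
      intro u v huv
      have key : ∀ k, s(u, v) = s(f.symm k, f.symm (k + 1)) → |f u - f v| ≤ 1 := by
        intro k hk
        rcases Sym2.eq_iff.1 hk with ⟨h1, h2⟩ | ⟨h1, h2⟩ <;>
          rw [h1, h2, f.apply_symm_apply, f.apply_symm_apply] <;> simp
      obtain ⟨-, c, ⟨-, k, -, hk⟩ | ⟨-, k, -, hk⟩⟩ := huv
      · exact key k hk
      · exact key k hk
    -- For `i = 0` the graph is a path on `ℤ`. Since `diam` takes the default value `0` when `ediam
    -- = ⊤`, positivity bounds all distances by `diam`, whereas `0` and `diam + 1` are further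
    -- apart.
    have htop : g.ediam ≠ ⊤ := SimpleGraph.ediam_ne_top_of_diam_ne_zero h.ne'
    have hne : Nonempty (coloredCycle 0).V := ⟨f.symm 0⟩
    obtain ⟨p, hp⟩ := (SimpleGraph.connected_of_ediam_ne_top htop).exists_walk_length_eq_dist
      (f.symm 0) (f.symm (g.diam + 1))
    have h1 := abs_sub_le_walk_length f hf p
    have h2 := SimpleGraph.dist_le_diam htop (u := f.symm 0) (v := f.symm (g.diam + 1))
    rw [f.apply_symm_apply, f.apply_symm_apply, hp, abs_sub_comm, sub_zero,
      abs_of_nonneg (by positivity)] at h1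
    omega
  · have : NeZero (2 * i) := ⟨by omega⟩
    exact inferInstanceAs (Finite (ZMod (2 * i)))

theorem finite_cayleyGraph (K : ResidualChain) (i : ℕ) : Finite (cayleyGraph K i).V :=
  have := K.finiteIndex i
  inferInstanceAs (Finite (GamABC ⧸ K.N i))

theorem core_eq_or (K : ResidualChain) (idx : ℕ → ℕ) (n : ℕ) :
    core K idx (n + 2) = coloredCycle (idx (n + 2)) ∨
      core K idx (n + 2) = cayleyGraph K (idx (n + 2)) := by
  unfold core
  by_cases h : Even n
  · exact .inl (if_pos h)
  · exact .inr (if_neg h)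

/-- This keeps the color `D` free for the edges that join different pieces of the construction. -/
theorem not_core_adj_D (K : ResidualChain) (idx : ℕ → ℕ) (n : ℕ) :
    ∀ x y : (core K idx n).V, ¬ (core K idx n).Adj .D x y := by
  match n with
  | 0 => simp [core, triangle]
  | 1 => simp [core, triangle]
  | n + 2 =>
    rcases core_eq_or K idx n with h | h <;> rw [h]
    · simp [coloredCycle]
    · simp [cayleyGraph]

theorem finite_core (K : ResidualChain) (idx : ℕ → ℕ) (n : ℕ)
    (hd : 0 < (core K idx (n + 2)).graph.diam) : Finite (core K idx (n + 2)).V := by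
  revert hd
  rcases core_eq_or K idx n with h | h <;> rw [h]
  · exact finite_coloredCycle _
  · exact fun _ => finite_cayleyGraph _ _

namespace Choices

variable {K : ResidualChain} {c : Choices K} {m : ℕ}

/-! ### Neighbors in `G` -/

theorem adj_point {e : Color} {z : c.Vert} (h : c.G.Adj e ⟨0, .point⟩ z) :
    e = .D ∧ z = ⟨1, .core 0 (c.a 1)⟩ := by
  obtain h | h := h
  · cases h
  -- The endpoint `c.root n` of `attach` is not a constructor application, so `cases` needs a
  -- variable in its place; the equation is analyzed afterwards.
  · generalize hy : (⟨0, .point⟩ : c.Vert) = y at h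
    cases h with
    | attach n =>
      obtain rfl : 0 = n := congrArg Sigma.fst hy
      exact ⟨rfl, rfl⟩
    | _ => exact absurd (congrArg Sigma.fst hy) (by simp)

theorem adj_core {n : ℕ} {v : (c.H (n + 1)).V} {e : Color} {z : c.Vert}
    (h : c.G.Adj e ⟨n + 1, .core n v⟩ z) :
    (∃ w, z = ⟨n + 1, .core n w⟩ ∧ (c.H (n + 1)).Adj e v w) ∨
    (e = .D ∧ v = c.a (n + 1) ∧ z = ⟨n, c.root n⟩) ∨
    (e = .D ∧ v = c.r (n + 1) ∧ z = ⟨n + 2, .core (n + 1) (c.a (n + 2))⟩) ∨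
    (e = .D ∧ c.part (n + 1) v ≤ n ∧ ∃ hv k hk, c.part (n + 1) v = k + 1 ∧
      z = ⟨n + 1, .copy n v hv k hk (c.root k)⟩) ∨
    (e = .D ∧ v = c.x (n + 1) ∧ ∃ h, z = ⟨n + 1, .path n ⟨0, h⟩⟩) := by
  obtain h | h := h
  · cases h with
    | core _ _ _ w h => exact .inl ⟨w, rfl, h⟩
    | attach => exact .inr (.inl ⟨rfl, rfl, rfl⟩)
    | attachCopy _ _ hv k hk h => exact .inr (.inr (.inr (.inl ⟨rfl, hv, hv, k, hk, h, rfl⟩)))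
    | pathStart _ h =>
      exact .inr (.inr (.inr (.inr ⟨pathColors_zero _ h, rfl, h, rfl⟩)))
  · generalize hy : (⟨n + 1, .core n v⟩ : c.Vert) = y at h
    cases h with
    | core _ _ u _ h =>
      cases hy
      exact .inl ⟨u, rfl, (c.H (n + 1)).symm h⟩
    | attach k =>
      obtain rfl : n + 1 = k := congrArg Sigma.fst hy
      rw [root, Sigma.mk.injEq] at hy
      have := eq_of_heq hy.2
      cases this
      exact .inr (.inr (.inl ⟨rfl, rfl, rfl⟩))
    | _ => cases hy

theorem adj_copy {n : ℕ} {v : (c.H (n + 1)).V} {hv : c.part (n + 1) v ≤ n} {k : ℕ}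
    {hk : k < c.part (n + 1) v} {y : c.New k} {e : Color} {z : c.Vert}
    (h : c.G.Adj e ⟨n + 1, .copy n v hv k hk y⟩ z) :
    (∃ l hl z', z = ⟨n + 1, .copy n v hv l hl z'⟩ ∧ c.G.Adj e ⟨k, y⟩ ⟨l, z'⟩) ∨
    (e = .D ∧ c.part (n + 1) v = k + 1 ∧ y = c.root k ∧ z = ⟨n + 1, .core n v⟩) := by
  obtain h | h := h
  · cases h with
    | copy _ _ _ _ _ _ _ l hl z' h => exact .inl ⟨l, hl, z', rfl, .inl h⟩
  · generalize hy : (⟨n + 1, .copy n v hv k hk y⟩ : c.Vert) = y at h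
    cases h with
    | copy _ _ _ _ l hl z' _ _ _ h =>
      cases hy
      exact .inl ⟨l, hl, z', rfl, .inr h⟩
    | attachCopy _ _ hv k hk h =>
      cases hy
      exact .inr ⟨rfl, h, rfl, rfl⟩
    | attach k =>
      obtain rfl : n + 1 = k := congrArg Sigma.fst hy
      rw [root, Sigma.mk.injEq] at hy
      cases eq_of_heq hy.2
    | _ => cases hy

theorem adj_path {n : ℕ} {j : Fin (pathColors (n + 1)).length} {e : Color} {z : c.Vert}
    (h : c.G.Adj e ⟨n + 1, .path n j⟩ z) :
    (e = (pathColors (n + 1))[j] ∧ j.1 = 0 ∧ z = ⟨n + 1, .core n (c.x (n + 1))⟩) ∨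
    (e = (pathColors (n + 1))[j] ∧
      ∃ i : Fin (pathColors (n + 1)).length, i.1 + 1 = j ∧ z = ⟨n + 1, .path n i⟩) ∨
    ∃ i : Fin (pathColors (n + 1)).length, j.1 + 1 = i ∧ z = ⟨n + 1, .path n i⟩ ∧
      e = (pathColors (n + 1))[i] := by
  obtain h | h := h
  · cases h with
    | pathStep _ j h => exact .inr (.inr ⟨⟨j + 1, h⟩, rfl, rfl, rfl⟩)
  · generalize hy : (⟨n + 1, .path n j⟩ : c.Vert) = y at h
    cases h with
    | pathStart _ h =>
      cases hy
      exact .inl ⟨rfl, rfl, rfl⟩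
    | pathStep _ i h =>
      cases hy
      exact .inr (.inl ⟨rfl, ⟨i, _⟩, rfl, rfl⟩)
    | attach k =>
      obtain rfl : n + 1 = k := congrArg Sigma.fst hy
      rw [root, Sigma.mk.injEq] at hy
      cases eq_of_heq hy.2
    | _ => cases hy

/-- Among all kinds of edges only `attach` joins vertices that are new in different steps, and it
joins consecutive ones. -/
theorem eq_of_adj_of_fst_lt {e : Color} {y z : c.Vert} {n : ℕ} (h : c.G.Adj e y z)
    (hy : y.1 ≤ n) (hz : n < z.1) :
    e = .D ∧ y = ⟨n, c.root n⟩ ∧ z = ⟨n + 1, .core n (c.a (n + 1))⟩ := by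
  obtain h | h := h
  · cases h <;> simp at hy hz <;> omega
  · cases h with
    | attach k =>
      obtain rfl : k = n := le_antisymm hy (Nat.lt_succ_iff.1 hz)
      exact ⟨rfl, rfl, rfl⟩
    | _ => simp at hy hz; omega

/-! ### The coloring is proper -/

theorem Valid.H_isProper (hc : c.Valid m) (n : ℕ) : (c.H (n + 1)).IsProper := by
  cases n with
  | zero => exact triangle_isProper
  | succ n => exact (hc.step (n + 2) (by omega)).isProper

theorem Valid.a_ne_r (hc : c.Valid m) (n : ℕ) : c.a (n + 1) ≠ c.r (n + 1) := by
  cases n with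
  | zero => exact hc.r_ne_a.symm
  | succ n =>
    have h := hc.step (n + 2) (by omega)
    intro h'
    have h1 := h.part_a
    have h2 := h.part_r
    simp only [← h', h1] at h2
    omega

/-- The vertices carrying copies lie in $R_1,\dots,R_n$, while $a$ lies in $R_{n+1}$ and $r, x$ in
$R_{n+2}$. In step 1 `part` is unconstrained, and `hk` excludes the value `0`. -/
theorem Valid.ne_of_part_le (hc : c.Valid m) {n k : ℕ} {v : (c.H (n + 1)).V}
    (hk : c.part (n + 1) v = k + 1) (hn : c.part (n + 1) v ≤ n) :
    v ≠ c.a (n + 1) ∧ v ≠ c.r (n + 1) ∧ v ≠ c.x (n + 1) := by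
  cases n with
  | zero => omega
  | succ n =>
    have h := hc.step (n + 2) (by omega)
    have h1 := h.part_a
    have h2 := h.part_r
    have h3 := h.part_x
    refine ⟨?_, ?_, ?_⟩ <;> rintro rfl <;> simp_all

theorem Valid.x_ne (hc : c.Valid m) {n : ℕ} (hn : 0 < (pathColors (n + 1)).length) :
    c.x (n + 1) ≠ c.a (n + 1) ∧ c.x (n + 1) ≠ c.r (n + 1) := by
  cases n with
  | zero => simp [pathColors, stepWord] at hn
  | succ n =>
    have h := hc.step (n + 2) (by omega)
    refine ⟨fun h' => ?_, h.r_ne_x.symm⟩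
    have h1 := h.part_a
    have h2 := h.part_x
    simp only [h', h1] at h2
    omega

theorem not_H_adj_D {n : ℕ} {v w : (c.H n).V} : ¬ (c.H n).Adj .D v w :=
  not_core_adj_D K c.idx n v w

theorem adj_root (n : ℕ) : c.G.Adj .D ⟨n, c.root n⟩ ⟨n + 1, .core n (c.a (n + 1))⟩ :=
  .inr (.attach n)

/-- At a vertex of $H_{n+1}$, the possible `D`-edges start at pairwise different vertices. Vertices
in copies are reduced to an earlier step by induction. -/
theorem Valid.eq_of_adj (hc : c.Valid m) {n : ℕ} {y : c.New n} {e : Color} {z z' : c.Vert}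
    (h : c.G.Adj e ⟨n, y⟩ z) (h' : c.G.Adj e ⟨n, y⟩ z') : z = z' := by
  induction n using Nat.strong_induction_on generalizing e z z' with
  | _ n ih =>
  cases y with
  | point => rw [(adj_point h).2, (adj_point h').2]
  | core n v =>
    have hp := fun k => hc.ne_of_part_le (n := n) (k := k) (v := v)
    have har := hc.a_ne_r n
    rcases adj_core h with ⟨w, rfl, hw⟩ | ⟨rfl, rfl, rfl⟩ | ⟨rfl, rfl, rfl⟩ |
        ⟨rfl, hv, _, k, hk, hk1, rfl⟩ | ⟨rfl, rfl, hl, rfl⟩ <;>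
      rcases adj_core h' with ⟨w', rfl, hw'⟩ | ⟨he, hv', rfl⟩ | ⟨he, hv', rfl⟩ |
        ⟨he, hv', _, k', hk', hk1', rfl⟩ | ⟨he, hv', hl', rfl⟩
    case inl.inl => rw [(hc.H_isProper n).proper _ _ _ _ hw hw']
    case inr.inr.inr.inl.inr.inr.inr.inl =>
      obtain rfl : k = k' := by omega
      rfl
    all_goals first
      | rfl
      | (subst he; exact absurd hw not_H_adj_D)
      | exact absurd hw' not_H_adj_D
      | exact absurd hv' har
      | exact absurd hv'.symm har
      | exact absurd hv' (hp k hk1 hv).1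
      | exact absurd hv' (hp k hk1 hv).2.1
      | exact absurd hv' (hp k hk1 hv).2.2
      | exact absurd rfl (hp k' hk1' hv').1
      | exact absurd rfl (hp k' hk1' hv').2.1
      | exact absurd rfl (hp k' hk1' hv').2.2
      | exact absurd hv' (hc.x_ne hl).1
      | exact absurd hv' (hc.x_ne hl).2
      | exact absurd hv'.symm (hc.x_ne hl').1
      | exact absurd hv'.symm (hc.x_ne hl').2
  | copy n v hv k hk y =>
    have hkn : k < n + 1 := by omega
    -- The root of a copy of $G_k$ gets a new `D`-edge. It has none inside the copy, because in $G$
    -- the unique `D`-edge at $r_k$ leads to step `k + 1`.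
    have key : ∀ {l z}, c.part (n + 1) v = k + 1 → y = c.root k → l < c.part (n + 1) v →
        ¬ c.G.Adj .D ⟨k, y⟩ ⟨l, z⟩ := by
      rintro l z h1 rfl hl hA
      have := congrArg Sigma.fst (ih k hkn hA (adj_root k))
      simp only at this
      omega
    rcases adj_copy h with ⟨l, hl, w, rfl, hw⟩ | ⟨rfl, h1, h2, rfl⟩ <;>
      rcases adj_copy h' with ⟨l', hl', w', rfl, hw'⟩ | ⟨he, h1', h2', rfl⟩
    · cases ih k hkn hw hw'
      rfl
    · subst he
      exact absurd hw (key h1' h2' hl)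
    · exact absurd hw' (key h1 h2 hl')
    · rfl
  | path n j =>
    rcases adj_path h with ⟨he, h0, rfl⟩ | ⟨he, i, hi, rfl⟩ | ⟨i, hi, rfl, he⟩ <;>
      rcases adj_path h' with ⟨he', h0', rfl⟩ | ⟨he', i', hi', rfl⟩ | ⟨i', hi', rfl, he'⟩ <;>
      first
      | rfl
      | omega
      | (obtain ⟨i, hi2⟩ := i
         obtain rfl : j.1 + 1 = i := hi
         exact absurd (he'.symm.trans he) (pathColors_succ_ne _ _ hi2))
      | (obtain ⟨i', hi2⟩ := i'
         obtain rfl : j.1 + 1 = i' := hi'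
         exact absurd (he.symm.trans he') (pathColors_succ_ne _ _ hi2))
      | (obtain rfl : i = i' := Fin.ext (by omega)
         rfl)

theorem Valid.color_eq (hc : c.Valid m) {n : ℕ} {y : c.New n} {e e' : Color} {z : c.Vert}
    (h : c.G.Adj e ⟨n, y⟩ z) (h' : c.G.Adj e' ⟨n, y⟩ z) : e = e' := by
  induction n using Nat.strong_induction_on generalizing e e' z with
  | _ n ih =>
  cases y with
  | point => rw [(adj_point h).1, (adj_point h').1]
  | core n v =>
    rcases adj_core h with ⟨w, rfl, hw⟩ | ⟨rfl, rfl, rfl⟩ | ⟨rfl, rfl, rfl⟩ |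
        ⟨rfl, hv, _, k, hk, hk1, rfl⟩ | ⟨rfl, rfl, hl, rfl⟩ <;>
      rcases adj_core h' with ⟨w', hz, hw'⟩ | ⟨he, hv', hz⟩ | ⟨he, hv', hz⟩ |
        ⟨he, hv', _, k', hk', hk1', hz⟩ | ⟨he, hv', hl', hz⟩
    case inl.inl =>
      cases hz
      exact (hc.H_isProper n).one_color _ _ _ _ hw hw'
    all_goals first
      | exact he.symm
      | cases hz
  | copy n v hv k hk y =>
    rcases adj_copy h with ⟨l, hl, w, rfl, hw⟩ | ⟨rfl, h1, h2, rfl⟩ <;>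
      rcases adj_copy h' with ⟨l', hl', w', hz, hw'⟩ | ⟨he, h1', h2', hz⟩
    · cases hz
      exact ih k (by omega) hw hw'
    · cases hz
    · cases hz
    · exact he.symm
  | path n j =>
    rcases adj_path h with ⟨rfl, h0, rfl⟩ | ⟨rfl, i, hi, rfl⟩ | ⟨i, hi, rfl, rfl⟩ <;>
      rcases adj_path h' with ⟨rfl, h0', hz⟩ | ⟨rfl, i', hi', hz⟩ | ⟨i', hi', hz, rfl⟩ <;>
      first
      | rfl
      | (cases hz <;> omega)
      | (cases hz; rfl)

theorem Valid.not_adj_self (hc : c.Valid m) {n : ℕ} {y : c.New n} {e : Color} :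
    ¬ c.G.Adj e ⟨n, y⟩ ⟨n, y⟩ := by
  intro h
  induction n using Nat.strong_induction_on generalizing e with
  | _ n ih =>
  cases y with
  | point => exact absurd (congrArg Sigma.fst (adj_point h).2) (by simp)
  | core n v =>
    rcases adj_core h with ⟨w, hz, hw⟩ | ⟨-, -, hz⟩ | ⟨-, -, hz⟩ |
        ⟨-, hv, _, k, hk, hk1, hz⟩ | ⟨-, -, hl, hz⟩
    · cases hz
      exact (hc.H_isProper n).no_loop _ _ hw
    · exact absurd (congrArg Sigma.fst hz) (by simp)
    · exact absurd (congrArg Sigma.fst hz) (by simp)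
    · cases hz
    · cases hz
  | copy n v hv k hk y =>
    rcases adj_copy h with ⟨l, hl, w, hz, hw⟩ | ⟨-, h1, h2, hz⟩
    · cases hz
      exact ih k (by omega) hw
    · cases hz
  | path n j =>
    rcases adj_path h with ⟨-, h0, hz⟩ | ⟨-, i, hi, hz⟩ | ⟨i, hi, hz, -⟩ <;> cases hz <;> omega

theorem Valid.G_isProper (hc : c.Valid m) : c.G.IsProper where
  no_loop _ _ := hc.not_adj_self
  one_color _ _ _ _ := hc.color_eq
  proper _ _ _ _ := hc.eq_of_adj

/-! ### The stages are finite and connected -/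

theorem Valid.diam_pos (hc : c.Valid m) (hm : 0 < m) (n : ℕ) :
    0 < (c.H (n + 2)).graph.diam :=
  lt_of_lt_of_le (by unfold s; positivity) (hc.step (n + 2) (by omega)).diam

theorem Valid.finite_H (hc : c.Valid m) (hm : 0 < m) (n : ℕ) : Finite (c.H (n + 1)).V := by
  cases n with
  | zero => exact inferInstanceAs (Finite (Fin 3))
  | succ n => exact finite_core K c.idx n (hc.diam_pos hm n)

/-- A disconnected graph would have `ediam = ⊤` and hence `diam = 0`. -/
theorem Valid.connected_H (hc : c.Valid m) (hm : 0 < m) (n : ℕ) :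
    (c.H (n + 1)).graph.Connected := by
  cases n with
  | zero => exact triangle_connected
  | succ n =>
    have : Nonempty (c.H (n + 2)).V := ⟨c.a (n + 2)⟩
    exact SimpleGraph.connected_of_ediam_ne_top
      (SimpleGraph.ediam_ne_top_of_diam_ne_zero (hc.diam_pos hm n).ne')

theorem Valid.finite_new (hc : c.Valid m) (hm : 0 < m) (n : ℕ) : Finite (c.New n) := by
  induction n using Nat.strong_induction_on with
  | _ n ih =>
  cases n with
  | zero =>
    have : Subsingleton (c.New 0) := ⟨fun y z => by cases y; cases z; rfl⟩
    infer_instance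
  | succ n =>
    have := hc.finite_H hm n
    have : ∀ k : Fin (n + 1), Finite (c.New k) := fun k => ih k k.2
    -- Triples that do not describe a vertex of a copy are sent to the dummy value `.core n v`.
    let f : ((c.H (n + 1)).V ⊕ (Σ _ : (c.H (n + 1)).V, Σ k : Fin (n + 1), c.New k)) ⊕
        Fin (pathColors (n + 1)).length → c.New (n + 1) := fun t => match t with
      | .inl (.inl v) => .core n v
      | .inl (.inr ⟨v, k, y⟩) => if h : c.part (n + 1) v ≤ n ∧ k < c.part (n + 1) v then
          .copy n v h.1 k h.2 y else .core n v
      | .inr j => .path n j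
    refine Finite.of_surjective f fun y => ?_
    cases y with
    | core _ v => exact ⟨.inl (.inl v), rfl⟩
    | copy _ v hv k hk y => exact ⟨.inl (.inr ⟨v, ⟨k, by omega⟩, y⟩), dif_pos ⟨hv, hk⟩⟩
    | path _ j => exact ⟨.inr j, rfl⟩

theorem Valid.finite_stage (hc : c.Valid m) (hm : 0 < m) (n : ℕ) : (c.stage n).Finite := by
  have := fun k : Fin (n + 1) => hc.finite_new hm k
  refine (Set.finite_range fun t : Σ k : Fin (n + 1), c.New k => (⟨t.1, t.2⟩ : c.Vert)).subset ?_
  rintro ⟨k, y⟩ hk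
  exact ⟨⟨⟨k, Nat.lt_succ_iff.2 hk⟩, y⟩, rfl⟩

theorem mem_stage {n k : ℕ} {y : c.New k} (h : k ≤ n) : (⟨k, y⟩ : c.Vert) ∈ c.stage n := h

/-- The graph `G_n`. -/
abbrev stageGraph (c : Choices K) (n : ℕ) : SimpleGraph (c.stage n) := 
  c.G.graph.induce (V := c.Vert) (c.stage n)

theorem Valid.stageGraph_adj (hc : c.Valid m) {n : ℕ} {y z : c.stage n} {e : Color}
    
    (h : c.G.Adj e (y : c.Vert) (z : c.Vert)) : (c.stageGraph n).Adj y z := by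
  refine ⟨fun hyz => ?_, e, h⟩
  change (y : c.Vert) = z at hyz
  rw [hyz] at h
  exact hc.not_adj_self h

/-- Induction on `n`: copies and the previous stage are connected to their own roots, and these and
the path are joined to the connected $H_n$. Reachability inside the stage, not just in $G$, is what
the genericity argument needs. -/
theorem Valid.reachable_root (hc : c.Valid m) (hm : 0 < m) (n : ℕ) (y : c.stage n) :
    (c.stageGraph n).Reachable y ⟨⟨n, c.root n⟩, mem_stage le_rfl⟩ := by
  induction n using Nat.strong_induction_on with
  | _ n ih =>
  obtain ⟨⟨k, y⟩, hk⟩ := y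
  change k ≤ n at hk
  cases n with
  | zero =>
    obtain rfl : k = 0 := by omega
    cases y
    rfl
  | succ n =>
    have hcore : ∀ v, (c.stageGraph (n + 1)).Reachable ⟨⟨n + 1, .core n v⟩, mem_stage le_rfl⟩
        ⟨⟨n + 1, c.root (n + 1)⟩, mem_stage le_rfl⟩ := by
      intro v
      let f : (c.H (n + 1)).graph →g c.stageGraph (n + 1) :=
        { toFun := fun v => ⟨⟨n + 1, .core n v⟩, mem_stage le_rfl⟩
          map_rel' := fun {v w} h => by
            obtain ⟨-, e, h⟩ := h
            exact hc.stageGraph_adj (.inl (.core n e v w h)) }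
      exact ((hc.connected_H hm n).preconnected v (c.r (n + 1))).map f
    rcases Nat.lt_or_ge n k with hkn | hkn
    · obtain rfl : k = n + 1 := by omega
      cases y with
      | core _ v => exact hcore v
      | copy _ v hv k hk y =>
        -- The copy attached to `v` is one of $G_i$ with `i = part - 1`.
        obtain ⟨i, hi⟩ : ∃ i, c.part (n + 1) v = i + 1 := ⟨_, (Nat.sub_add_cancel (by omega)).symm⟩
        let f : c.stageGraph i →g c.stageGraph (n + 1) :=
          { toFun := fun z => ⟨⟨n + 1, .copy n v hv z.1.1
              (hi ▸ Nat.lt_succ_iff.2 z.2) z.1.2⟩, mem_stage le_rfl⟩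
            map_rel' := fun {y z} h => by
              obtain ⟨-, e, h | h⟩ := h
              · exact hc.stageGraph_adj (.inl (.copy n v hv e _ _ _ _ _ _ h))
              · exact hc.stageGraph_adj (.inr (.copy n v hv e _ _ _ _ _ _ h)) }
        have h1 := (ih i (by omega) ⟨⟨k, y⟩, mem_stage (by omega)⟩).map f
        have h2 : (c.stageGraph (n + 1)).Reachable (f ⟨⟨i, c.root i⟩, mem_stage le_rfl⟩)
            ⟨⟨n + 1, .core n v⟩, mem_stage le_rfl⟩ :=
          (hc.stageGraph_adj (.inr (.attachCopy n v hv i (by omega) hi))).reachable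
        exact (h1.trans h2).trans (hcore v)
      | path _ j =>
        obtain ⟨j, hj⟩ := j
        induction j with
        | zero =>
          exact (hc.stageGraph_adj (z := ⟨⟨n + 1, .core n (c.x (n + 1))⟩, mem_stage le_rfl⟩)
            (.inr (.pathStart n hj))).reachable.trans (hcore _)
        | succ j ih =>
          exact (hc.stageGraph_adj (z := ⟨⟨n + 1, .path n ⟨j, Nat.lt_of_succ_lt hj⟩⟩, mem_stage le_rfl⟩)
            (.inr (.pathStep n j hj))).reachable.trans (ih _)
    · have h1 := (ih n (by omega) ⟨⟨k, y⟩, mem_stage hkn⟩).map (c.G.graph.induceHomOfLE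
        (show c.stage n ≤ c.stage (n + 1) from fun z hz => Nat.le_succ_of_le hz)).toHom
      have h2 : (c.stageGraph (n + 1)).Reachable ⟨⟨n, c.root n⟩, mem_stage (Nat.le_succ n)⟩
          ⟨⟨n + 1, .core n (c.a (n + 1))⟩, mem_stage le_rfl⟩ := (hc.stageGraph_adj (adj_root n)).reachable
      exact (h1.trans h2).trans (hcore _)

theorem Valid.stageGraph_preconnected (hc : c.Valid m) (hm : 0 < m) (n : ℕ) :
    (c.stageGraph n).Preconnected :=
  fun y z => (hc.reachable_root hm n y).trans (hc.reachable_root hm n z).symm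

theorem Valid.G_isFourColored (hc : c.Valid m) (hm : 0 < m) : c.G.IsFourColored where
  infinite := Infinite.of_injective (fun n => (⟨n, c.root n⟩ : c.Vert))
    fun _ _ h => congrArg Sigma.fst h
  connected := by
    have : Nonempty c.G.V := ⟨(⟨0, .point⟩ : c.Vert)⟩
    refine ⟨fun (y : c.Vert) (z : c.Vert) => ?_⟩
    exact (hc.stageGraph_preconnected hm (max y.1 z.1) ⟨y, mem_stage (le_max_left _ _)⟩
      ⟨z, mem_stage (le_max_right _ _)⟩).map (SimpleGraph.Embedding.induce _).toHom
  isProper := hc.G_isProper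

end Choices

/-! ### Genericity -/

/-- Two finite sets of vertices of the same size in an infinite connected graph are equal if they
meet, are connected and each of them has just one edge leaving it. Here `S` is the image
of the connected graph `g`, and so is `T`. -/
theorem range_eq_of_unique_boundary {V W : Type*} [Finite W] [Infinite V] {𝒢 : SimpleGraph V}
    (h𝒢 : 𝒢.Preconnected) {g : SimpleGraph W} (hg : g.Preconnected) (f f' : g →g 𝒢)
    (hf : Function.Injective f) (hf' : Function.Injective f') {a b a' b' : V}
    (h : ∀ u v, 𝒢.Adj u v → u ∈ Set.range f → v ∉ Set.range f → u = a ∧ v = b)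
    (h' : ∀ u v, 𝒢.Adj u v → u ∈ Set.range f' → v ∉ Set.range f' → u = a' ∧ v = b')
    {w w' : W} (hw : f w = f' w') : Set.range f = Set.range f' := by
  by_contra hne
  have hcard : (Set.range f).ncard = (Set.range f').ncard := by
    rw [Set.ncard_range_of_injective hf, Set.ncard_range_of_injective hf']
  have hnot : ¬ Set.range f ⊆ Set.range f' := fun hs =>
    hne (Set.eq_of_subset_of_ncard_le hs hcard.ge)
  have hnot' : ¬ Set.range f' ⊆ Set.range f := fun hs =>
    hne (Set.eq_of_subset_of_ncard_le hs hcard.le).symm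
  obtain ⟨_, ⟨p, rfl⟩, hp⟩ := Set.not_subset.1 hnot
  obtain ⟨_, ⟨q, rfl⟩, hq⟩ := Set.not_subset.1 hnot'
  -- A walk inside `range f` from the common vertex to a vertex outside `range f'` uses the only
  -- edge leaving `range f'`, so `b'` lies in `range f`; symmetrically for `b`.
  obtain ⟨d, -, hd, hd'⟩ := (hg w p).some.exists_boundary_dart (f ⁻¹' Set.range f')
    ⟨w', hw.symm⟩ hp
  obtain ⟨e, -, he, he'⟩ := (hg w' q).some.exists_boundary_dart (f' ⁻¹' Set.range f)
    ⟨w, hw⟩ hq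
  have hb' : b' ∈ Set.range f := (h' _ _ (f.map_adj d.adj) hd hd').2 ▸ ⟨d.snd, rfl⟩
  have hb : b ∈ Set.range f' := (h _ _ (f'.map_adj e.adj) he he').2 ▸ ⟨e.snd, rfl⟩
  -- Some edge leaves the finite union. It leaves one of the two sets, so it ends in `b` or `b'`,
  -- but both are in the union.
  obtain ⟨z, hz⟩ := ((Set.finite_range f).union (Set.finite_range f')).exists_notMem
  obtain ⟨d, -, hd, hd'⟩ := (h𝒢 (f w) z).some.exists_boundary_dart
    (Set.range f ∪ Set.range f') (.inl ⟨w, rfl⟩) hz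
  rw [Set.mem_union, not_or] at hd'
  rcases hd with hd | hd
  · exact hd'.2 ((h _ _ d.adj hd hd'.1).2 ▸ hb)
  · exact hd'.1 ((h' _ _ d.adj hd hd'.2).2 ▸ hb')

namespace Choices

variable {K : ResidualChain} {c : Choices K} {m : ℕ}

/-- Walks within the stage are recorded instead of distances, since the ball isomorphism carries
them to walks around its other center. -/
theorem Valid.exists_stage_subset_ball (hc : c.Valid m) (hm : 0 < m) (n : ℕ) (x : c.stage n) :
    ∃ r : ℕ, ∀ y : c.stage n, ∃ p : (c.stageGraph n).Walk x y, p.length ≤ r := by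
  have := (hc.finite_stage hm n).to_subtype
  let p := fun y => (hc.stageGraph_preconnected hm n x y).some
  obtain ⟨r, hr⟩ := (Set.finite_range fun y => (p y).length).bddAbove
  exact ⟨r, fun y => ⟨p y, hr ⟨y, rfl⟩⟩⟩

theorem stage_boundary {n : ℕ} {u v : c.Vert} (h : c.G.graph.Adj u v)
    (hu : u ∈ c.stage n) (hv : v ∉ c.stage n) :
    u = ⟨n, c.root n⟩ ∧ v = ⟨n + 1, .core n (c.a (n + 1))⟩ := by
  obtain ⟨-, e, h⟩ := h
  exact (eq_of_adj_of_fst_lt h hu (not_le.1 hv)).2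

theorem Valid.G_isGeneric (hc : c.Valid m) (hm : 0 < m) : c.G.IsGeneric := by
  intro (x : c.Vert) (y : c.Vert) hxy
  have h4 := hc.G_isFourColored hm
  have : Infinite c.G.V := h4.infinite
  obtain ⟨n, hx, hy⟩ : ∃ n, x ∈ c.stage n ∧ y ∈ c.stage n :=
    ⟨max x.1 y.1, mem_stage (le_max_left _ _), mem_stage (le_max_right _ _)⟩
  obtain ⟨r, hr⟩ := hc.exists_stage_subset_ball hm n ⟨x, hx⟩
  -- The extra `1` puts the outer end of the leaving edge into the ball of `x`, and all neighbors of
  -- the image of $G_n$ into the ball of `y`.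
  refine ⟨r + 1, r.succ_pos, ?_⟩
  rintro ⟨θ, hθx, hθ⟩
  apply hxy
  have := (hc.finite_stage hm n).to_subtype
  have hg := hc.stageGraph_preconnected hm n
  let i : c.stageGraph n →g c.G.graph := (SimpleGraph.Embedding.induce _).toHom
  have hi : Function.Injective i := Subtype.val_injective
  have hball : ∀ u : c.stage n, (i u : c.G.V) ∈ c.G.ball x (r + 1) := by
    intro u
    obtain ⟨p, hp⟩ := hr u
    refine (p.map i).edist_le.trans ?_
    rw [SimpleGraph.Walk.length_map]
    exact_mod_cast hp.trans r.le_succ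
  let f : c.stageGraph n →g c.G.graph :=
    { toFun := fun u => θ ⟨i u, hball u⟩
      map_rel' := fun {u v} h => by
        obtain ⟨h1, e, h2⟩ := i.map_adj h
        exact ⟨fun h' => h1 (Subtype.mk.inj (θ.injective (Subtype.ext h'))), e,
          (hθ e _ _).1 h2⟩ }
  have hf : Function.Injective f := fun u v h =>
    hi (Subtype.mk.inj (θ.injective (Subtype.ext h)))
  have hfx : f ⟨x, hx⟩ = y := hθx _ rfl
  have hedist : ∀ u : c.stage n, c.G.graph.edist y (f u) ≤ r := by
    intro u
    obtain ⟨p, hp⟩ := hr u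
    rw [← hfx]
    refine (p.map f).edist_le.trans ?_
    rw [SimpleGraph.Walk.length_map]
    exact_mod_cast hp
  have houter : (⟨n + 1, .core n (c.a (n + 1))⟩ : c.Vert) ∈ c.G.ball x (r + 1) := by
    obtain ⟨p, hp⟩ := hr ⟨⟨n, c.root n⟩, mem_stage le_rfl⟩
    have h1 : c.G.graph.edist x (⟨n, c.root n⟩ : c.Vert) ≤ r := by
      refine (p.map i).edist_le.trans ?_
      rw [SimpleGraph.Walk.length_map]
      exact_mod_cast hp
    have h2 : c.G.graph.Adj (⟨n, c.root n⟩ : c.Vert) (⟨n + 1, .core n (c.a (n + 1))⟩ : c.Vert) :=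
      ⟨fun h => absurd (congrArg Sigma.fst h) (by simp), .D, adj_root n⟩
    exact SimpleGraph.edist_triangle.trans
      (add_le_add h1 (SimpleGraph.edist_eq_one_iff_adj.2 h2).le)
  -- An edge leaving the image still lies in the ball of `y`, so it pulls back under `θ` to an edge
  -- leaving $G_n$, of which there is only one.
  have hboundary : ∀ u v, c.G.graph.Adj u v → u ∈ Set.range f → v ∉ Set.range f →
      u = f ⟨⟨n, c.root n⟩, mem_stage le_rfl⟩ ∧ v = θ ⟨_, houter⟩ := by
    rintro _ v ⟨h1, e, h2⟩ ⟨u, rfl⟩ hv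
    have hadj : c.G.graph.Adj (f u) v := ⟨h1, e, h2⟩
    have hvb : v ∈ c.G.ball y (r + 1) := SimpleGraph.edist_triangle.trans
      (add_le_add (hedist u) (SimpleGraph.edist_eq_one_iff_adj.2 hadj).le)
    obtain ⟨w, hw⟩ := θ.surjective ⟨v, hvb⟩
    obtain rfl : (θ w : c.G.V) = v := congrArg Subtype.val hw
    have hA : c.G.Adj e (i u) w := (hθ e ⟨i u, hball u⟩ w).2 h2
    have hwn : w.1 ∉ c.stage n := fun h => hv ⟨⟨w.1, h⟩, rfl⟩
    obtain ⟨-, h3, h4⟩ := eq_of_adj_of_fst_lt hA u.2 (not_le.1 hwn)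
    exact ⟨congrArg f (Subtype.ext h3), congrArg (fun t => (θ t : c.G.V)) (Subtype.ext h4)⟩
  have hrange : Set.range f = Set.range i := by
    refine range_eq_of_unique_boundary h4.connected.preconnected hg f i hf hi hboundary
      (a' := (⟨n, c.root n⟩ : c.Vert)) (b' := (⟨n + 1, .core n (c.a (n + 1))⟩ : c.Vert)) ?_
      (w := ⟨x, hx⟩) (w' := ⟨y, hy⟩) hfx
    intro u v h hu hv
    have hri : Set.range i = c.stage n := Subtype.range_coe
    rw [hri] at hu hv
    exact stage_boundary h hu hv
  -- As the image of $G_n$ is $G_n$, the image of its leaving edge also leaves $G_n$, so it is the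
  -- same edge.
  have hroot : f ⟨⟨n, c.root n⟩, mem_stage le_rfl⟩ = (⟨n, c.root n⟩ : c.Vert) := by
    have h1 : f ⟨⟨n, c.root n⟩, mem_stage le_rfl⟩ ∈ c.stage n := by
      obtain ⟨u, hu⟩ : f ⟨⟨n, c.root n⟩, mem_stage le_rfl⟩ ∈ Set.range i := hrange ▸ ⟨_, rfl⟩
      exact hu ▸ u.2
    have h2 : (θ ⟨_, houter⟩).1 ∉ c.stage n := by
      intro h
      obtain ⟨u, hu⟩ : (θ ⟨_, houter⟩ : c.G.V) ∈ Set.range f := hrange ▸ ⟨⟨_, h⟩, rfl⟩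
      have h3 : (u : c.Vert) = ⟨n + 1, .core n (c.a (n + 1))⟩ :=
        Subtype.mk.inj (θ.injective (Subtype.ext hu))
      have h4 : (u : c.Vert).1 ≤ n := u.2
      rw [h3] at h4
      exact Nat.not_succ_le_self n h4
    exact (eq_of_adj_of_fst_lt ((hθ .D ⟨_, hball ⟨⟨n, c.root n⟩, mem_stage le_rfl⟩⟩
      ⟨_, houter⟩).1 (adj_root n)) h1 (not_le.1 h2)).2.1
  have hfix : ∀ u : c.stage n, f u = i u := by
    intro u
    by_contra hu
    -- On an edge from a fixed to a moved vertex, the edge and its image have the same color and the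
    -- same starting vertex, against properness.
    obtain ⟨d, -, hd, hd'⟩ := (hg ⟨⟨n, c.root n⟩, mem_stage le_rfl⟩ u).some.exists_boundary_dart
      {u | f u = i u} hroot hu
    obtain ⟨-, e, h2⟩ := i.map_adj d.adj
    have h3 : c.G.Adj e (f d.fst) (f d.snd) := (hθ e ⟨_, hball d.fst⟩ ⟨_, hball d.snd⟩).1 h2
    rw [show f d.fst = i d.fst from hd] at h3
    exact hd' (h4.isProper.proper _ _ _ _ h3 h2)
  exact (hfix ⟨x, hx⟩).symm.trans hfx

end Choices

theorem mainTheorem6 (m : ℕ) (hm : 10 < m) (K : ResidualChain) (c : Choices K)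
    (hc : c.Valid m) : c.G.IsFourColored ∧ c.G.IsGeneric :=
  ⟨hc.G_isFourColored (by omega), hc.G_isGeneric (by omega)⟩
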